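/- Let $n,d\in\mathbb{N}$ with $d$ even and positive, and let $\mathbf{K}\subset\mathbb{R}^n$ be compact with nonempty interior. Let $\mathbf{P}[\mathbf{x}]_d$ be the set of nonnegative homogeneous polynomials $g$ of degree $d$ in $\mathbf{x}=(x_1,\ldots,x_n)$ whose sublevel set $\{\mathbf{x}\in\mathbb{R}^n: g(\mathbf{x})\le 1\}$ has finite Lebesgue volume, and let $C_d(\mathbf{K})$ be the set of polynomials of degree at most $d$ that are nonnegative on $\mathbf{K}$. Consider the optimization problem $$\mathcal{P}:\qquad \inf_{g\in\mathbf{P}[\mathbf{x}]_d}\Big\{\int_{\mathbb{R}^n}\exp(-g(\mathbf{x}))\,d\mathbf{x}\;:\;1-g\in C_d(\mathbf{K})\Big\}.$$ Let $\|\mathbf{x}\|_d:=\big(\sum_{i=1}^n x_i^d\big)^{1/d}$ and $\xi_n^d:=\{\mathbf{x}\in\mathbb{R}^n:\|\mathbf{x}\|_d\le 1\}$. Suppose that $g^*$ is an optimal solution of $\mathcal{P}$ and that $\mathbf{G}_1^*:=\{\mathbf{x}: g^*(\mathbf{x})\le 1\}=\xi_n^d$. Then there are an integer $0\le s\le\binom{n+d-1}{d}$,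 distinct contact points $\mathbf{x}^*(1),\ldots,\mathbf{x}^*(s)\in\mathbf{K}\cap\xi_n^d$ with $\|\mathbf{x}^*(j)\|_d=1$ for all $j$, and weights $\lambda_1^*,\ldots,\lambda_s^*>0$ such that for every $\alpha\in\mathbb{N}^n$ with $|\alpha|=\sum_i\alpha_i=d$, $$\sum_{j=1}^s\lambda_j^*\,(\mathbf{x}^*(j))^\alpha=\begin{cases}\displaystyle\prod_{i=1}^n\int_{\mathbb{R}}t^{\alpha_i}\exp(-t^d)\,dt & \text{if all } \alpha_i \text{ are even},\\[1ex] 0 & \text{otherwise.}\end{cases}$$ -/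

import Mathlib

namespace FormVolume

/-- The sublevel set `G₁ = {x ∈ ℝⁿ : g(x) ≤ 1}` of a polynomial `g`. -/
def sublevelOne {n : ℕ} (g : MvPolynomial (Fin n) ℝ) : Set (Fin n → ℝ) :=
  {x | MvPolynomial.eval x g ≤ 1}

/-- `P[x]_d`: the nonnegative homogeneous polynomials of degree `d` in `n` variables whose
sublevel set `G₁` has finite Lebesgue volume. -/
def finiteVolumeForms (n d : ℕ) : Set (MvPolynomial (Fin n) ℝ) :=
  {g | g.IsHomogeneous d ∧ (∀ x, 0 ≤ MvPolynomial.eval x g) ∧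
    MeasureTheory.volume (sublevelOne g) < ⊤}

/-- `C_d(K)`: the polynomials of degree at most `d` that are nonnegative on `K`. -/
def nonnegCone {n : ℕ} (d : ℕ) (K : Set (Fin n → ℝ)) : Set (MvPolynomial (Fin n) ℝ) :=
  {f | f.totalDegree ≤ d ∧ ∀ x ∈ K, 0 ≤ MvPolynomial.eval x f}

/-- The objective `g ↦ ∫_{ℝⁿ} exp(-g(x)) dx`. For `g ∈ P[x]_d` with `d > 0` the integrand is
integrable, so on the feasible set this is the usual integral. -/
noncomputable def expIntegral {n : ℕ} (g : MvPolynomial (Fin n) ℝ) : ℝ :=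
  ∫ x : Fin n → ℝ, Real.exp (-(MvPolynomial.eval x g))

/-- The feasible set of the optimization problem: the `g ∈ P[x]_d` with `1 - g ∈ C_d(K)`. -/
def feasibleSet {n : ℕ} (d : ℕ) (K : Set (Fin n → ℝ)) : Set (MvPolynomial (Fin n) ℝ) :=
  {g | g ∈ finiteVolumeForms n d ∧ 1 - g ∈ nonnegCone d K}

/-- `g` is an optimal solution of `inf {∫ exp(-g) dx : g ∈ P[x]_d, 1 - g ∈ C_d(K)}`. -/
def IsOptimalSolution {n : ℕ} (d : ℕ) (K : Set (Fin n → ℝ)) (g : MvPolynomial (Fin n) ℝ) : Prop :=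
  g ∈ feasibleSet d K ∧ ∀ h ∈ feasibleSet d K, expIntegral g ≤ expIntegral h

/-- The `d`-norm `‖x‖_d = (∑ᵢ xᵢ^d)^{1/d}`, for even `d`. -/
noncomputable def dNorm {n : ℕ} (d : ℕ) (x : Fin n → ℝ) : ℝ :=
  (∑ i, x i ^ d) ^ (1 / (d : ℝ))

/-- The unit ball `ξ_n^d = {x ∈ ℝⁿ : ‖x‖_d ≤ 1}` of the `d`-norm. -/
def dUnitBall (n d : ℕ) : Set (Fin n → ℝ) :=
  {x | dNorm d x ≤ 1}

end FormVolume

open MeasureTheory Set Filter Topology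

/-! Write S(x) = ∑ xᵢ^d. A nonnegative form of degree d is determined by its unit sublevel set, so
the optimal g equals S pointwise. If a form h of degree d is positive at every contact point (x ∈ K,
S(x) = 1), then S - t h is feasible for small t > 0, and optimality forces ∫ h exp(-S) ≥ 0
(`integral_eval_mul_exp_nonneg`). By Hahn–Banach, the degree-d moment vector of exp(-S), suitably
scaled, then lies in the convex hull of the monomial vectors of the contact points; otherwise a
separating functional would be a form h violating that inequality. Carathéodory on a hyperplane
gives at most binom(n+d-1, d) points, and Fubini with parity computes the moments. -/

theorem isCompact_convexHull_of_finiteDimensional {E : Type*} [NormedAddCommGroup E]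
    [NormedSpace ℝ E] [FiniteDimensional ℝ E] {s : Set E} (hs : IsCompact s) :
    IsCompact (convexHull ℝ s) := by
  -- Carathéodory: at most dim + 1 points suffice, so the hull is a finite union of continuous
  -- images of compact sets.
  have key : convexHull ℝ s = ⋃ k ∈ Finset.range (Module.finrank ℝ E + 2),
      (fun p : (Fin k → ℝ) × (Fin k → E) => ∑ i, p.1 i • p.2 i) ''
        (stdSimplex ℝ (Fin k) ×ˢ Set.univ.pi fun _ => s) := by
    apply Subset.antisymm
    · intro x hx
      obtain ⟨ι, _, z, w, hz, hzi, hw, hw1, hwz⟩ := eq_pos_convex_span_of_mem_convexHull hx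
      have hc : Fintype.card ι ≤ Module.finrank ℝ E + 1 :=
        hzi.card_le_finrank_succ.trans (Nat.add_le_add_right (Submodule.finrank_le _) 1)
      let e := (Fintype.equivFin ι).symm
      refine mem_biUnion (x := Fintype.card ι) (Finset.mem_coe.2 (Finset.mem_range.2 (by lia)))
        ⟨(w ∘ e, z ∘ e), ⟨⟨fun i => (hw _).le, ?_⟩, fun i _ => hz ⟨_, rfl⟩⟩, ?_⟩
      · simpa using (Equiv.sum_comp e w).trans hw1
      · simpa using (Equiv.sum_comp e fun i => w i • z i).trans hwz
    · refine iUnion₂_subset fun k _ => ?_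
      rintro _ ⟨⟨w, z⟩, ⟨hw, hz⟩, rfl⟩
      exact (convex_convexHull ℝ s).sum_mem (fun i _ => hw.1 i) hw.2
        fun i _ => subset_convexHull ℝ s (hz i trivial)
  rw [key]
  refine Finset.isCompact_biUnion _ fun k _ => ?_
  exact ((isCompact_stdSimplex ℝ (Fin k)).prod (isCompact_univ_pi fun _ => hs)).image
    (by fun_prop)

/-- Carathéodory's theorem for points on an affine hyperplane missing the origin: the number of
points is at most the dimension. -/
theorem exists_pos_combination_of_mem_convexHull {E : Type*} [AddCommGroup E]
    [Module ℝ E] [FiniteDimensional ℝ E] {s : Set E} (l : E →ₗ[ℝ] ℝ) (hl : ∀ y ∈ s, l y = 1)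
    {x : E} (hx : x ∈ convexHull ℝ s) :
    ∃ (k : ℕ) (z : Fin k → E) (w : Fin k → ℝ), k ≤ Module.finrank ℝ E ∧ Function.Injective z ∧
      (∀ i, z i ∈ s) ∧ (∀ i, 0 < w i) ∧ ∑ i, w i • z i = x := by
  obtain ⟨ι, _, z, w, hz, hzi, hw, hw1, hwz⟩ := eq_pos_convex_span_of_mem_convexHull hx
  -- Applying `l` to a vanishing combination shows its coefficients sum to zero, so affine
  -- independence upgrades to linear independence, saving one point.
  have hli : LinearIndependent ℝ z := by
    rw [Fintype.linearIndependent_iff]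
    intro c hc i
    have h0 : ∑ j, c j = 0 := by
      have := congrArg l hc
      simpa [hl _ (hz ⟨_, rfl⟩)] using this
    exact affineIndependent_iff.1 hzi Finset.univ c h0 hc i (Finset.mem_univ i)
  let e := (Fintype.equivFin ι).symm
  refine ⟨Fintype.card ι, z ∘ e, w ∘ e, hli.fintype_card_le_finrank,
    hli.injective.comp e.injective, fun i => hz ⟨_, rfl⟩, fun i => hw _, ?_⟩
  simpa using (Equiv.sum_comp e fun i => w i • z i).trans hwz

/-! ### Moments of exp(-c ∑ xᵢ^d) -/

theorem integrable_pow_mul_exp_neg_mul_pow (k : ℕ) {d : ℕ} (hd : 0 < d) (he : Even d) {c : ℝ}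
    (hc : 0 < c) : Integrable fun t : ℝ => t ^ k * Real.exp (-(c * t ^ d)) := by
  have hpos : IntegrableOn (fun t : ℝ => t ^ k * Real.exp (-(c * t ^ d))) (Ioi 0) := by
    have := integrableOn_rpow_mul_exp_neg_mul_rpow (p := d) (s := k) (b := c)
      (by have : (0 : ℝ) ≤ k := k.cast_nonneg
          linarith) (by exact_mod_cast hd) hc
    simpa only [Real.rpow_natCast, neg_mul] using this
  rw [← integrableOn_univ, ← Iic_union_Ioi (a := (0 : ℝ)), integrableOn_union]
  refine ⟨?_, hpos⟩
  rw [integrableOn_Iic_iff_integrableOn_Iio,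
    ← (Measure.measurePreserving_neg (volume : Measure ℝ)).integrableOn_comp_preimage
      (Homeomorph.neg ℝ).measurableEmbedding]
  have hpre : (Neg.neg : ℝ → ℝ) ⁻¹' Iio 0 = Ioi 0 := by ext; simp
  rw [hpre]
  refine IntegrableOn.congr_fun (Integrable.const_mul hpos ((-1) ^ k)) (fun t _ => ?_) measurableSet_Ioi
  simp only [Function.comp, he.neg_pow]
  rw [neg_pow t k]
  ring

theorem prod_pow_mul_exp_neg_sum {n d : ℕ} (c : ℝ) (a : Fin n → ℕ) (x : Fin n → ℝ) :
    (∏ i, x i ^ a i) * Real.exp (-(c * ∑ i, x i ^ d)) =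
      ∏ i, (x i ^ a i * Real.exp (-(c * x i ^ d))) := by
  rw [Finset.prod_mul_distrib, ← Real.exp_sum, Finset.mul_sum, Finset.sum_neg_distrib]

theorem integrable_prod_pow_mul_exp_neg {n d : ℕ} (hd : 0 < d) (he : Even d) {c : ℝ}
    (hc : 0 < c) (a : Fin n → ℕ) :
    Integrable fun x : Fin n → ℝ => (∏ i, x i ^ a i) * Real.exp (-(c * ∑ i, x i ^ d)) := by
  simp_rw [prod_pow_mul_exp_neg_sum]
  exact Integrable.fintype_prod (f := fun i (t : ℝ) => t ^ a i * Real.exp (-(c * t ^ d)))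
    fun i => integrable_pow_mul_exp_neg_mul_pow (a i) hd he hc

theorem integrable_sum_pow_mul_exp_neg {n d : ℕ} (hd : 0 < d) (he : Even d) {c : ℝ}
    (hc : 0 < c) :
    Integrable fun x : Fin n → ℝ => (∑ i, x i ^ d) * Real.exp (-(c * ∑ i, x i ^ d)) := by
  simp_rw [Finset.sum_mul]
  refine integrable_finsetSum _ fun j _ => ?_
  refine (integrable_prod_pow_mul_exp_neg hd he hc (Pi.single j d)).congr (ae_of_all _ fun x => ?_)
  dsimp only
  rw [Finset.prod_eq_single j] <;> simp +contextual

theorem integrable_exp_neg_sum_pow {n d : ℕ} (hd : 0 < d) (he : Even d) {c : ℝ} (hc : 0 < c) :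
    Integrable fun x : Fin n → ℝ => Real.exp (-(c * ∑ i, x i ^ d)) := by
  simpa using integrable_prod_pow_mul_exp_neg hd he hc (0 : Fin n → ℕ)

theorem integral_pow_mul_exp_neg_pow_eq_zero {k d : ℕ} (hk : ¬ Even k) (he : Even d) :
    ∫ t : ℝ, t ^ k * Real.exp (-(t ^ d)) = 0 := by
  have h := integral_neg_eq_self (fun t : ℝ => t ^ k * Real.exp (-(t ^ d))) volume
  simp only [he.neg_pow, (Nat.not_even_iff_odd.1 hk).neg_pow, neg_mul, integral_neg] at h
  linarith

theorem integral_prod_pow_mul_exp_neg {n d : ℕ} (he : Even d) (a : Fin n → ℕ) :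
    ∫ x : Fin n → ℝ, (∏ i, x i ^ a i) * Real.exp (-∑ i, x i ^ d) =
      if ∀ i, Even (a i) then ∏ i, ∫ t : ℝ, t ^ a i * Real.exp (-(t ^ d)) else 0 := by
  have h : ∫ x : Fin n → ℝ, (∏ i, x i ^ a i) * Real.exp (-∑ i, x i ^ d) =
      ∏ i, ∫ t : ℝ, t ^ a i * Real.exp (-(t ^ d)) := by
    rw [← integral_fintype_prod_volume_eq_prod
      fun i (t : ℝ) => t ^ a i * Real.exp (-(t ^ d))]
    congr 1 with x
    simpa using prod_pow_mul_exp_neg_sum 1 a x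
  rw [h]
  split_ifs with ha
  · rfl
  · push Not at ha
    obtain ⟨i, hi⟩ := ha
    exact Finset.prod_eq_zero (Finset.mem_univ i)
      (integral_pow_mul_exp_neg_pow_eq_zero (Nat.not_even_iff_odd.2 (by simpa using hi)) he)

theorem norm_pow_le_sum_pow {n d : ℕ} (hd : 0 < d) (he : Even d) (x : Fin n → ℝ) :
    ‖x‖ ^ d ≤ ∑ i, x i ^ d := by
  rcases isEmpty_or_nonempty (Fin n) with _ | _
  · simp [Subsingleton.elim x 0, hd.ne']
  · obtain ⟨i, hi⟩ := Finite.exists_max fun i => ‖x i‖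
    refine (pow_le_pow_left₀ (norm_nonneg x) ((pi_norm_le_iff_of_nonempty _).2 hi) d).trans ?_
    rw [Real.norm_eq_abs, he.pow_abs]
    exact Finset.single_le_sum (f := fun i => x i ^ d) (fun j _ => he.pow_nonneg _)
      (Finset.mem_univ i)

theorem abs_prod_pow_le {n d : ℕ} (hd : 0 < d) (he : Even d) {a : Fin n → ℕ}
    (ha : ∑ i, a i = d) (x : Fin n → ℝ) : |∏ i, x i ^ a i| ≤ ∑ i, x i ^ d := by
  refine le_trans ?_ (norm_pow_le_sum_pow hd he x)
  rw [Finset.abs_prod, ← ha, ← Finset.prod_pow_eq_pow_sum]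
  refine Finset.prod_le_prod (fun i _ => abs_nonneg _) fun i _ => ?_
  rw [abs_pow]
  exact pow_le_pow_left₀ (abs_nonneg _) (norm_le_pi_norm x i) _

namespace FormVolume

/-! ### Forms of degree d and first-order optimality -/

theorem dNorm_le_one_iff {n d : ℕ} (hd : 0 < d) (he : Even d) (x : Fin n → ℝ) :
    dNorm d x ≤ 1 ↔ ∑ i, x i ^ d ≤ 1 := by
  have h0 : 0 ≤ ∑ i, x i ^ d := Finset.sum_nonneg fun i _ => he.pow_nonneg _
  have hp : (0 : ℝ) < 1 / d := by positivity
  refine ⟨fun h => ?_, fun h => Real.rpow_le_one h0 h hp.le⟩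
  by_contra! h1
  exact (Real.one_lt_rpow h1 hp).not_ge h

theorem le_of_forall_pow_mul_le_one {d : ℕ} (hd : 0 < d) {p q : ℝ} (hp : 0 ≤ p)
    (h : ∀ r : ℝ, r ^ d * p ≤ 1 → r ^ d * q ≤ 1) : q ≤ p := by
  by_contra! hpq
  have hm : 0 < (p + q) / 2 := by linarith
  have hr := Real.rpow_inv_natCast_pow (inv_pos.2 hm).le hd.ne'
  -- This r satisfies r^d = 2/(p+q), which separates p from q even when p = 0.
  have := h (((p + q) / 2)⁻¹ ^ (d : ℝ)⁻¹)
  rw [hr, inv_mul_le_one₀ hm, inv_mul_le_one₀ hm] at this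
  linarith [this (by linarith)]

/-- Both sides scale by r^d along each line through 0, so membership of all r • x in the common
sublevel set fixes the value. -/
theorem eval_eq_sum_pow_of_sublevelOne_eq {n d : ℕ} (hd : 0 < d) (he : Even d)
    {g : MvPolynomial (Fin n) ℝ} (hg : g.IsHomogeneous d)
    (hg0 : ∀ x, 0 ≤ MvPolynomial.eval x g) (hball : sublevelOne g = dUnitBall n d)
    (x : Fin n → ℝ) : MvPolynomial.eval x g = ∑ i, x i ^ d := by
  have key (r : ℝ) : r ^ d * MvPolynomial.eval x g ≤ 1 ↔ r ^ d * ∑ i, x i ^ d ≤ 1 := by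
    have h1 : r • x ∈ sublevelOne g ↔ r • x ∈ dUnitBall n d := by rw [hball]
    change MvPolynomial.eval (r • x) g ≤ 1 ↔ dNorm d (r • x) ≤ 1 at h1
    rw [dNorm_le_one_iff hd he] at h1
    have h2 : MvPolynomial.eval (r • x) g = r ^ d * MvPolynomial.eval x g := by
      rw [MvPolynomial.eval_eq', MvPolynomial.eval_eq', Finset.mul_sum]
      refine Finset.sum_congr rfl fun a ha => ?_
      have had : ∑ i, a i = d := by
        rw [← Finsupp.degree_eq_sum, Finsupp.degree_eq_weight_one]
        exact hg (MvPolynomial.mem_support_iff.1 ha)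
      simp only [Pi.smul_apply, smul_eq_mul, mul_pow, Finset.prod_mul_distrib,
        Finset.prod_pow_eq_pow_sum, had]
      ring
    simpa [h2, mul_pow, ← Finset.mul_sum] using h1
  exact le_antisymm
    (le_of_forall_pow_mul_le_one hd (Finset.sum_nonneg fun i _ => he.pow_nonneg _)
      fun r => (key r).2)
    (le_of_forall_pow_mul_le_one hd (hg0 x) fun r => (key r).1)

theorem exists_abs_eval_le_mul_sum_pow {n d : ℕ} (hd : 0 < d) (he : Even d)
    {h : MvPolynomial (Fin n) ℝ} (hh : h.IsHomogeneous d) :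
    ∃ C > 0, ∀ x, |MvPolynomial.eval x h| ≤ C * ∑ i, x i ^ d := by
  refine ⟨∑ a ∈ h.support, |h.coeff a| + 1, by positivity, fun x => ?_⟩
  have h0 : 0 ≤ ∑ i, x i ^ d := Finset.sum_nonneg fun i _ => he.pow_nonneg _
  rw [MvPolynomial.eval_eq', add_mul, Finset.sum_mul]
  refine (Finset.abs_sum_le_sum_abs _ _).trans
    (le_add_of_le_of_nonneg (Finset.sum_le_sum fun a ha => ?_) (by simpa using h0))
  rw [abs_mul]
  refine mul_le_mul_of_nonneg_left (abs_prod_pow_le hd he ?_ x) (abs_nonneg _)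
  rw [← Finsupp.degree_eq_sum, Finsupp.degree_eq_weight_one]
  exact hh (MvPolynomial.mem_support_iff.1 ha)

theorem exists_isHomogeneous_eval_eq {n d : ℕ}
    (c : ((Finset.univ : Finset (Fin n)).finsuppAntidiag d) → ℝ) :
    ∃ h : MvPolynomial (Fin n) ℝ, h.IsHomogeneous d ∧
      ∀ x, MvPolynomial.eval x h = ∑ a, c a * ∏ i, x i ^ (a : Fin n →₀ ℕ) i := by
  refine ⟨∑ a, MvPolynomial.monomial a.1 (c a), ?_, fun x => ?_⟩
  · refine MvPolynomial.IsHomogeneous.sum _ _ _ fun a _ =>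
      MvPolynomial.isHomogeneous_monomial _ ?_
    rw [Finsupp.degree_eq_sum]
    exact (Finset.mem_finsuppAntidiag.1 a.2).1
  · simp [MvPolynomial.eval_monomial, Finsupp.prod_fintype]

theorem measure_sublevelOne_lt_top {n d : ℕ} (hd : 0 < d) (he : Even d)
    {f : MvPolynomial (Fin n) ℝ} {c : ℝ} (hc : 0 < c)
    (hf : ∀ x, c * ∑ i, x i ^ d ≤ MvPolynomial.eval x f) :
    volume (sublevelOne f) < ⊤ := by
  refine (Metric.isBounded_closedBall (x := (0 : Fin n → ℝ)) (r := 1 + 1 / c)).subset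
    (fun x hx => ?_) |>.measure_lt_top
  have h1 : c * ‖x‖ ^ d ≤ 1 := (mul_le_mul_of_nonneg_left (norm_pow_le_sum_pow hd he x) hc.le).trans
    ((hf x).trans hx)
  rw [mem_closedBall_zero_iff]
  by_contra! hlt
  have hc' : 0 < 1 / c := by positivity
  have h2 : ‖x‖ ≤ ‖x‖ ^ d := le_self_pow₀ (by linarith) hd.ne'
  rw [← le_div_iff₀' hc] at h1
  linarith

/-- Where h > 0, subtracting t h only helps. The rest of K is compact and misses S = 1, so S ≤ M < 1
there and the slack 1 - M absorbs -t h ≤ t C. -/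
theorem exists_forall_sub_mul_le_one {n : ℕ} {K : Set (Fin n → ℝ)} (hK : IsCompact K)
    {S h : (Fin n → ℝ) → ℝ} (hS : Continuous S) (hh : Continuous h) {C : ℝ} (hC : 0 < C)
    (hhC : ∀ x, |h x| ≤ C * S x) (hSK : ∀ x ∈ K, S x ≤ 1) (hpos : ∀ x ∈ K, S x = 1 → 0 < h x) :
    ∃ δ > 0, ∀ t, 0 < t → t < δ → ∀ x ∈ K, S x - t * h x ≤ 1 := by
  obtain ⟨M, hM1, hM⟩ : ∃ M < 1, ∀ x ∈ K ∩ {x | h x ≤ 0}, S x ≤ M := by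
    rcases (K ∩ {x | h x ≤ 0}).eq_empty_or_nonempty with h0 | h0
    · exact ⟨0, one_pos, by simp [h0]⟩
    · obtain ⟨y, hy, hmax⟩ := (hK.inter_right (isClosed_le hh continuous_const)).exists_isMaxOn
        h0 hS.continuousOn
      exact ⟨S y, lt_of_le_of_ne (hSK y hy.1) fun hy1 => (hpos y hy.1 hy1).not_ge hy.2,
        fun x hx => hmax hx⟩
  refine ⟨(1 - M) / C, div_pos (by linarith) hC, fun t ht htd x hx => ?_⟩
  rw [lt_div_iff₀ hC] at htd
  rcases le_or_gt (h x) 0 with h0 | h0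
  · have h1 : -h x ≤ C := by
      have := (neg_le_abs (h x)).trans (hhC x)
      nlinarith [hSK x hx]
    nlinarith [hM x ⟨hx, h0⟩]
  · nlinarith [hSK x hx]

/-- First-order optimality: a direction which is positive at all contact points has nonnegative
moment against the optimal density. -/
theorem IsOptimalSolution.integral_eval_mul_exp_nonneg {n d : ℕ} (hd : 0 < d) (he : Even d)
    {K : Set (Fin n → ℝ)} (hK : IsCompact K) {g : MvPolynomial (Fin n) ℝ}
    (hg : IsOptimalSolution d K g) (hgS : ∀ x, MvPolynomial.eval x g = ∑ i, x i ^ d)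
    {h : MvPolynomial (Fin n) ℝ} (hh : h.IsHomogeneous d)
    (hpos : ∀ x ∈ K, ∑ i, x i ^ d = 1 → 0 < MvPolynomial.eval x h) :
    0 ≤ ∫ x : Fin n → ℝ, MvPolynomial.eval x h * Real.exp (-∑ i, x i ^ d) := by
  obtain ⟨⟨⟨hghom, hg0, hgvol⟩, hgdeg, hgK⟩, hopt⟩ := hg
  obtain ⟨C, hC, hhC⟩ := exists_abs_eval_le_mul_sum_pow hd he hh
  have hS0 (x : Fin n → ℝ) : 0 ≤ ∑ i, x i ^ d := Finset.sum_nonneg fun i _ => he.pow_nonneg _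
  have hScont : Continuous fun x : Fin n → ℝ => ∑ i, x i ^ d := by fun_prop
  have hhcont : Continuous fun x => MvPolynomial.eval x h := MvPolynomial.continuous_eval h
  obtain ⟨δ, hδ, hδK⟩ := exists_forall_sub_mul_le_one hK hScont hhcont hC hhC
    (fun x hx => by simpa [hgS] using hgK x hx) hpos
  -- The bound S - t h ≥ S/2 yields nonnegativity, finite volume and an integrable dominating
  -- function at once.
  have hlow {t : ℝ} (ht : 0 < t) (htC : t < 1 / (2 * C)) (x : Fin n → ℝ) :
      1 / 2 * ∑ i, x i ^ d ≤ ∑ i, x i ^ d - t * MvPolynomial.eval x h := by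
    rw [lt_div_iff₀ (by positivity)] at htC
    have h1 := (le_abs_self _).trans (hhC x)
    nlinarith [mul_le_mul_of_nonneg_left h1 ht.le, hS0 x]
  have hsmall : ∀ᶠ t : ℝ in 𝓝[>] 0, 0 < t ∧ t < δ ∧ t < 1 / (2 * C) := by
    have h1 : ∀ᶠ t : ℝ in 𝓝[>] 0, t ∈ Ioo 0 (min δ (1 / (2 * C))) :=
      Ioo_mem_nhdsGT (lt_min hδ (by positivity))
    filter_upwards [h1] with t ht
    exact ⟨ht.1, ht.2.trans_le (min_le_left _ _), ht.2.trans_le (min_le_right _ _)⟩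
  have hbound {t : ℝ} (ht : 0 < t) (htC : t < 1 / (2 * C)) (x : Fin n → ℝ) :
      ‖MvPolynomial.eval x h * Real.exp (-(∑ i, x i ^ d - t * MvPolynomial.eval x h))‖ ≤
        C * ((∑ i, x i ^ d) * Real.exp (-(1 / 2 * ∑ i, x i ^ d))) := by
    rw [norm_mul, Real.norm_eq_abs, Real.norm_eq_abs, Real.abs_exp, ← mul_assoc]
    exact mul_le_mul (hhC x) (Real.exp_le_exp.2 (neg_le_neg (hlow ht htC x)))
      (Real.exp_pos _).le ((abs_nonneg _).trans (hhC x))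
  have hdom : Integrable fun x : Fin n → ℝ =>
      C * ((∑ i, x i ^ d) * Real.exp (-(1 / 2 * ∑ i, x i ^ d))) :=
    (integrable_sum_pow_mul_exp_neg hd he one_half_pos).const_mul C
  have hlim : Tendsto (fun t : ℝ => ∫ x : Fin n → ℝ, MvPolynomial.eval x h *
      Real.exp (-(∑ i, x i ^ d - t * MvPolynomial.eval x h))) (𝓝[>] 0)
      (𝓝 (∫ x : Fin n → ℝ, MvPolynomial.eval x h * Real.exp (-∑ i, x i ^ d))) := by
    refine tendsto_integral_filter_of_dominated_convergence _
      (Eventually.of_forall fun t => Continuous.aestronglyMeasurable (by fun_prop))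
      (hsmall.mono fun t ht => ae_of_all _ (hbound ht.1 ht.2.2)) hdom (ae_of_all _ fun x => ?_)
    have hc : Continuous fun t : ℝ => MvPolynomial.eval x h *
        Real.exp (-(∑ i, x i ^ d - t * MvPolynomial.eval x h)) := by fun_prop
    simpa using (hc.tendsto 0).mono_left nhdsWithin_le_nhds
  refine ge_of_tendsto hlim (hsmall.mono fun t ⟨ht, htδ, htC⟩ => ?_)
  have heval (x : Fin n → ℝ) : MvPolynomial.eval x (g - MvPolynomial.C t * h) =
      ∑ i, x i ^ d - t * MvPolynomial.eval x h := by simp [hgS]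
  have hhom : (g - MvPolynomial.C t * h).IsHomogeneous d :=
    hghom.sub (by simpa using (MvPolynomial.isHomogeneous_C _ t).mul hh)
  have hfeas : g - MvPolynomial.C t * h ∈ feasibleSet d K := by
    refine ⟨⟨hhom, fun x => ?_, measure_sublevelOne_lt_top hd he one_half_pos fun x => ?_⟩,
      ?_, fun x hx => ?_⟩
    · rw [heval]
      exact (by have := hS0 x; positivity : (0 : ℝ) ≤ 1 / 2 * ∑ i, x i ^ d).trans (hlow ht htC x)
    · rw [heval]
      exact hlow ht htC x
    · refine (MvPolynomial.totalDegree_sub _ _).trans (max_le (by simp) hhom.totalDegree_le)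
    · rw [map_sub, map_one, heval, sub_nonneg]
      exact hδK t ht htδ x hx
  have hle := hopt _ hfeas
  simp only [expIntegral, heval, hgS] at hle
  have hint0 : Integrable fun x : Fin n → ℝ => Real.exp (-∑ i, x i ^ d) := by
    simpa using integrable_exp_neg_sum_pow (n := n) hd he one_pos
  have hint1 : Integrable fun x : Fin n → ℝ =>
      Real.exp (-(∑ i, x i ^ d - t * MvPolynomial.eval x h)) := by
    refine (integrable_exp_neg_sum_pow hd he one_half_pos).mono'
      (Continuous.aestronglyMeasurable (by fun_prop)) (ae_of_all _ fun x => ?_)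
    rw [Real.norm_eq_abs, Real.abs_exp]
    exact Real.exp_le_exp.2 (neg_le_neg (hlow ht htC x))
  have hint2 : Integrable fun x : Fin n → ℝ => MvPolynomial.eval x h *
      Real.exp (-(∑ i, x i ^ d - t * MvPolynomial.eval x h)) :=
    hdom.mono' (Continuous.aestronglyMeasurable (by fun_prop)) (ae_of_all _ (hbound ht htC))
  -- Convexity of exp at the perturbed point: exp(-S) ≥ (1 - t h) exp(-(S - t h)). With optimality
  -- this signs the integral for each small t, so only a limit is needed, not a derivative.
  have hconv : (∫ x : Fin n → ℝ, Real.exp (-(∑ i, x i ^ d - t * MvPolynomial.eval x h))) -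
      t * ∫ x : Fin n → ℝ, MvPolynomial.eval x h *
        Real.exp (-(∑ i, x i ^ d - t * MvPolynomial.eval x h)) ≤
      ∫ x : Fin n → ℝ, Real.exp (-∑ i, x i ^ d) := by
    rw [← integral_const_mul, ← integral_sub hint1 (hint2.const_mul t)]
    refine integral_mono (hint1.sub (hint2.const_mul t)) hint0 fun x => ?_
    have h1 := Real.add_one_le_exp (-(t * MvPolynomial.eval x h))
    have h2 : Real.exp (-∑ i, x i ^ d) = Real.exp (-(t * MvPolynomial.eval x h)) *
        Real.exp (-(∑ i, x i ^ d - t * MvPolynomial.eval x h)) := by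
      rw [← Real.exp_add]
      congr 1
      ring
    dsimp only
    rw [h2]
    nlinarith [Real.exp_pos (-(∑ i, x i ^ d - t * MvPolynomial.eval x h))]
  exact nonneg_of_mul_nonneg_right (by linarith) ht

/-! ### Separation and the quadrature formula -/

theorem integral_sum_pow_mul_exp_neg_pos {n d : ℕ} (hn : 0 < n) (hd : 0 < d) (he : Even d) :
    0 < ∫ x : Fin n → ℝ, (∑ i, x i ^ d) * Real.exp (-∑ i, x i ^ d) := by
  have hS0 (x : Fin n → ℝ) : 0 ≤ ∑ i, x i ^ d := Finset.sum_nonneg fun i _ => he.pow_nonneg _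
  refine integral_pos_of_integrable_nonneg_nonzero (x := fun _ => 1) (by fun_prop) ?_
    (fun x => mul_nonneg (hS0 x) (Real.exp_pos _).le) ?_
  · simpa using integrable_sum_pow_mul_exp_neg (n := n) hd he one_pos
  · simp [hn.ne']

theorem exists_quadrature_of_isOptimalSolution {n d : ℕ} (hn : 0 < n) (hd : 0 < d) (he : Even d)
    {K : Set (Fin n → ℝ)} (hK : IsCompact K) {g : MvPolynomial (Fin n) ℝ}
    (hg : IsOptimalSolution d K g) (hgS : ∀ x, MvPolynomial.eval x g = ∑ i, x i ^ d) :
    ∃ (s : ℕ) (x : Fin s → (Fin n → ℝ)) (w : Fin s → ℝ),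
      s ≤ (n + d - 1).choose d ∧ Function.Injective x ∧
      (∀ j, x j ∈ K ∧ ∑ i, x j i ^ d = 1) ∧ (∀ j, 0 < w j) ∧
      ∀ α : Fin n → ℕ, ∑ i, α i = d →
        ∑ j, w j * ∏ i, x j i ^ α i =
          ∫ x : Fin n → ℝ, (∏ i, x i ^ α i) * Real.exp (-∑ i, x i ^ d) := by
  let I := (Finset.univ : Finset (Fin n)).finsuppAntidiag d
  let v : (Fin n → ℝ) → I → ℝ := fun x a => ∏ i, x i ^ (a : Fin n →₀ ℕ) i
  let b : I → ℝ := fun a => ∫ x, v x a * Real.exp (-∑ i, x i ^ d)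
  let m := ∫ x : Fin n → ℝ, (∑ i, x i ^ d) * Real.exp (-∑ i, x i ^ d)
  have hm : 0 < m := integral_sum_pow_mul_exp_neg_pos hn hd he
  let T : Set (Fin n → ℝ) := K ∩ {x | ∑ i, x i ^ d = 1}
  have hT : IsCompact T := hK.inter_right (isClosed_eq (by fun_prop) continuous_const)
  have hvint (a : I) : Integrable fun x : Fin n → ℝ => v x a * Real.exp (-∑ i, x i ^ d) := by
    simpa using integrable_prod_pow_mul_exp_neg hd he one_pos (a : Fin n →₀ ℕ)
  let p (j : Fin n) : I := ⟨Finsupp.single j d, by simp [I, Finset.mem_finsuppAntidiag]⟩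
  let l : (I → ℝ) →ₗ[ℝ] ℝ := ∑ j, LinearMap.proj (p j)
  have hvp (x : Fin n → ℝ) (j : Fin n) : v x (p j) = x j ^ d := by
    dsimp only [v, p]
    rw [Finset.prod_eq_single j] <;> simp +contextual [eq_comm]
  have hlv (x : Fin n → ℝ) : l (v x) = ∑ i, x i ^ d := by simp [l, hvp]
  have hlb : l b = m := by
    simp only [l, b, m, LinearMap.sum_apply, LinearMap.proj_apply]
    rw [← integral_finsetSum _ fun j _ => hvint (p j)]
    simp only [hvp, Finset.sum_mul]
  -- Dividing by m puts `b` on the hyperplane l = 1, which contains `v '' T`.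
  have hmem : m⁻¹ • b ∈ convexHull ℝ (v '' T) := by
    by_contra hnot
    obtain ⟨f, u, hfb, hfT⟩ := geometric_hahn_banach_point_closed (convex_convexHull ℝ _)
      (isCompact_convexHull_of_finiteDimensional
        (hT.image (by fun_prop : Continuous v))).isClosed hnot
    -- Since l = 1 on `v '' T`, subtracting `u • l` absorbs the threshold: F is linear, positive on
    -- `v '' T` and negative at `b`.
    let F : (I → ℝ) →ₗ[ℝ] ℝ := f.toLinearMap - u • l
    have hF (y : I → ℝ) : F y = ∑ a, F (Pi.single a 1) * y a := by
      conv_lhs => rw [pi_eq_sum_univ' y, map_sum]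
      refine Finset.sum_congr rfl fun a _ => ?_
      rw [map_smul, smul_eq_mul, mul_comm]
    obtain ⟨h, hh, hheval⟩ := exists_isHomogeneous_eval_eq fun a : I => F (Pi.single a 1)
    have hhF (x : Fin n → ℝ) : MvPolynomial.eval x h = F (v x) := (hheval x).trans (hF _).symm
    have h1 := hg.integral_eval_mul_exp_nonneg hd he hK hgS hh fun x hx hx1 => by
      have := hfT _ (subset_convexHull ℝ _ ⟨x, ⟨hx, hx1⟩, rfl⟩)
      rw [hhF]
      simpa [F, hlv, hx1] using this
    have h2 : ∫ x : Fin n → ℝ, MvPolynomial.eval x h * Real.exp (-∑ i, x i ^ d) = F b := by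
      simp_rw [hhF, hF (v _), hF b, Finset.sum_mul, mul_assoc]
      rw [integral_finsetSum _ fun a _ => (hvint a).const_mul _]
      simp_rw [integral_const_mul]
      rfl
    have h3 : F b < 0 := by
      rw [map_smul, smul_eq_mul, inv_mul_lt_iff₀ hm] at hfb
      simp only [F, LinearMap.sub_apply, LinearMap.smul_apply, hlb, smul_eq_mul]
      change f b - u * m < 0
      linarith
    linarith
  obtain ⟨s, z, w, hs, hz, hzT, hw, hsum⟩ := exists_pos_combination_of_mem_convexHull l
    (by rintro _ ⟨x, hx, rfl⟩; exact (hlv x).trans hx.2) hmem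
  choose x hxT hxz using hzT
  refine ⟨s, x, fun j => m * w j, ?_, fun i j hij => hz ?_, fun j => hxT j,
    fun j => mul_pos hm (hw j), fun α hα => ?_⟩
  · simpa [I, Finset.card_finsuppAntidiag_nat_eq_choose] using hs
  · rw [← hxz, ← hxz, hij]
  · let a : I := ⟨Finsupp.equivFunOnFinite.symm α, by simp [I, Finset.mem_finsuppAntidiag, hα]⟩
    have h1 : ∑ j, w j * v (x j) a = m⁻¹ * b a := by
      simpa [hxz] using congrFun hsum a
    calc ∑ j, m * w j * ∏ i, x j i ^ α i = m * ∑ j, w j * v (x j) a := by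
          rw [Finset.mul_sum]
          exact Finset.sum_congr rfl fun j _ => mul_assoc _ _ _
      _ = b a := by rw [h1, mul_inv_cancel_left₀ hm.ne']
      _ = _ := rfl

end FormVolume

theorem corollary3p3 (n d : ℕ) (hd : 0 < d) (hd_even : Even d)
    (K : Set (Fin n → ℝ)) (hK : IsCompact K) (hK_int : (interior K).Nonempty)
    (g : MvPolynomial (Fin n) ℝ) (hg : FormVolume.IsOptimalSolution d K g)
    (hball : FormVolume.sublevelOne g = FormVolume.dUnitBall n d) :
    ∃ (s : ℕ) (x : Fin s → (Fin n → ℝ)) (w : Fin s → ℝ),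
      s ≤ (n + d - 1).choose d ∧
      Function.Injective x ∧
      (∀ j, x j ∈ K ∩ FormVolume.dUnitBall n d ∧ FormVolume.dNorm d (x j) = 1) ∧
      (∀ j, 0 < w j) ∧
      ∀ α : Fin n → ℕ, ∑ i, α i = d →
        ∑ j, w j * ∏ i, x j i ^ α i =
          if ∀ i, Even (α i) then
            ∏ i, ∫ t : ℝ, t ^ α i * Real.exp (-(t ^ d))
          else 0 := by
  rcases n.eq_zero_or_pos with rfl | hn
  -- For n = 0 no exponent has degree d > 0, so the empty rule works; the normalizer m would vanish
  -- here.
  · refine ⟨0, Fin.elim0, Fin.elim0, Nat.zero_le _, fun i => i.elim0, fun i => i.elim0,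
      fun i => i.elim0, fun α hα => ?_⟩
    simp at hα
    omega
  · obtain ⟨s, x, w, hs, hx, hxK, hw, hsum⟩ :=
      FormVolume.exists_quadrature_of_isOptimalSolution hn hd hd_even hK hg
        (FormVolume.eval_eq_sum_pow_of_sublevelOne_eq hd hd_even hg.1.1.1 hg.1.1.2.1 hball)
    have hnorm (j : Fin s) : FormVolume.dNorm d (x j) = 1 := by
      rw [FormVolume.dNorm, (hxK j).2, Real.one_rpow]
    exact ⟨s, x, w, hs, hx, fun j => ⟨⟨(hxK j).1, (hnorm j).le⟩, hnorm j⟩, hw,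
      fun α hα => (hsum α hα).trans (integral_prod_pow_mul_exp_neg hd_even α)⟩
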